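/- Let $k$ be a natural number and let $s,q\in\mathbb{C}$. Put $[n]:=1+q+\cdots+q^{n-1}$, which equals $(1-q^n)/(1-q)$ when $q\neq1$. Assume that $[n]\neq0$ for $1\le n\le k$, that $1+s[n]\neq0$ for $1\le n<k$, and that $1-q+s\neq0$. Put $\nu:=s/(1-q+s)$. Let $L_+:=\{x\in\mathbb{Z}^k : x_1\ge x_2\ge\cdots\ge x_k\}$. The cluster coordinate of $x\in L_+$ is the tuple $(c_1,\ldots,c_M)$ of positive integers with $\sum_i c_i=k$ that gives the lengths of the successive maximal blocks of equal coordinates of $x$. With $v_1,\ldots,v_k$ the standard basis of $\mathbb{Z}^k$, define the linear operator $\mathcal{H}(s,q)$ on functions $f:L_+\to\mathbb{C}$ by $$(\mathcal{H}(s,q)f)(x)=\sum_{i=1}^{M}\sum_{r=1}^{c_i}\frac{s^{r-1}}{[r]}\prod_{p=0}^{r-1}\frac{[c_i-p]}{1+s[c_i-1-p]}\Bigl(f\bigl(x-\textstyle\sum_{p=0}^{r-1}v_{c_1+\cdots+c_i-p}\bigr)-f(x)\Bigr).$$ Let $z_1,\ldots,z_k\in\mathbb{C}$ be distinct, with $z_i\neq1$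 and $\nu z_i\neq1$ for all $i$, and define $\Psi_z:L_+\to\mathbb{C}$ by $$\Psi_z(x)=\sum_{\sigma\in\mathfrak{S}_k}\ \prod_{1\le i<j\le k}\frac{qz_{\sigma(i)}-z_{\sigma(j)}}{z_{\sigma(i)}-z_{\sigma(j)}}\ \prod_{i=1}^{k}\left(\frac{1-\nu z_{\sigma(i)}}{1-z_{\sigma(i)}}\right)^{x_i}.$$ Then $\Psi_z$ is an eigenfunction of $\mathcal{H}(s,q)$: it is not identically zero, and $$\mathcal{H}(s,q)\Psi_z=\Bigl((\nu-1)\sum_{i=1}^{k}\frac{z_i}{1-\nu z_i}\Bigr)\Psi_z .$$ -/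

import Mathlib

open Finset

noncomputable section

namespace QBoson

/-- The `q`-integer `[n] = (1 - q ^ n) / (1 - q)`, written as `1 + q + ⋯ + q ^ (n - 1)`
so that it is also meaningful at `q = 1`. -/
def qInt (q : ℂ) (n : ℕ) : ℂ := ∑ i ∈ range n, q ^ i

theorem qInt_eq (q : ℂ) (hq : q ≠ 1) (n : ℕ) : qInt q n = (1 - q ^ n) / (1 - q) := by
  have h1 : q - 1 ≠ 0 := sub_ne_zero.mpr hq
  have h2 : 1 - q ≠ 0 := sub_ne_zero.mpr hq.symm
  rw [qInt, geom_sum_eq hq, div_eq_div_iff h1 h2]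
  ring

/-- The integral points `x = (x₁ ≥ x₂ ≥ ⋯ ≥ x_k)` of the closed fundamental chamber. They are
the configurations of `k` bosonic particles on `ℤ`, the particles being at `x₁, …, x_k`. -/
def Chamber (k : ℕ) : Type := {x : Fin k → ℤ // Antitone x}

/-- The number of particles of `x` at the site `a`. For fixed `x`, as
`a` runs over its occupied sites in decreasing order, these numbers form the cluster coordinate
`(c₁, …, c_M)` of `x`. -/
def clusterSize {k : ℕ} (x : Chamber k) (a : ℤ) : ℕ := #{i : Fin k | x.1 i = a}

/-- The occupied sites of `x`; they index the clusters of `x`. -/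
def sites {k : ℕ} (x : Chamber k) : Finset ℤ := univ.image x.1

/-- The configuration obtained from `x` by lowering by one the last `r` coordinates of the cluster
at the site `a`, that is, by moving `r` particles from `a` to `a - 1`. -/
def move {k : ℕ} (x : Chamber k) (a : ℤ) (r : ℕ) : Chamber k :=
  ⟨fun i => if x.1 i = a ∧ #{j : Fin k | i < j ∧ x.1 j = a} < r then x.1 i - 1 else x.1 i, by
    intro i j hij
    have hx : x.1 j ≤ x.1 i := x.2 hij
    have hc : #{l : Fin k | j < l ∧ x.1 l = a} ≤ #{l : Fin k | i < l ∧ x.1 l = a} := by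
      apply card_le_card
      intro l hl
      simp only [mem_filter, mem_univ, true_and] at hl ⊢
      exact ⟨lt_of_le_of_lt hij hl.1, hl.2⟩
    dsimp only
    split_ifs with h1 h2 h2
    · omega
    · omega
    · rcases hx.lt_or_eq with h | h
      · omega
      · exact absurd ⟨h.trans h2.1, lt_of_le_of_lt hc h2.2⟩ h1
    · exact hx⟩

/-- The rate at which `r` particles leave a cluster with `c` particles, `1 ≤ r ≤ c`. -/
def rate (s q : ℂ) (c r : ℕ) : ℂ :=
  s ^ (r - 1) / qInt q r * ∏ p ∈ range r, qInt q (c - p) / (1 + s * qInt q (c - 1 - p))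

/-- The (backward) generator `𝓗(s, q)`, a linear operator on the functions on the chamber. -/
def generator (k : ℕ) (s q : ℂ) : (Chamber k → ℂ) →ₗ[ℂ] (Chamber k → ℂ) where
  toFun f x := ∑ a ∈ sites x, ∑ r ∈ Icc 1 (clusterSize x a),
    rate s q (clusterSize x a) r * (f (move x a r) - f x)
  map_add' f g := by
    funext x
    simp only [Pi.add_apply, ← sum_add_distrib]
    refine sum_congr rfl fun a _ => sum_congr rfl fun r _ => ?_
    ring
  map_smul' t f := by
    funext x
    simp only [Pi.smul_apply, smul_eq_mul, RingHom.id_apply, mul_sum]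
    refine sum_congr rfl fun a _ => sum_congr rfl fun r _ => ?_
    ring

/-- The parameter `ν = s / (1 - q + s)`. -/
def nu (s q : ℂ) : ℂ := s / (1 - q + s)

/-- The function `Ψ_z` on the chamber. -/
def Psi {k : ℕ} (s q : ℂ) (z : Fin k → ℂ) (x : Chamber k) : ℂ :=
  ∑ σ : Equiv.Perm (Fin k),
    (∏ i : Fin k, ∏ j ∈ Ioi i, (q * z (σ i) - z (σ j)) / (z (σ i) - z (σ j))) *
      ∏ i : Fin k, ((1 - nu s q * z (σ i)) / (1 - z (σ i))) ^ x.1 i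

end QBoson

end

namespace QBoson

/-! ### `q`-integers, `q`-factorials and `q`-binomial coefficients -/

@[simp] theorem qInt_zero (q : ℂ) : qInt q 0 = 0 := by simp [qInt]

@[simp] theorem qInt_one (q : ℂ) : qInt q 1 = 1 := by simp [qInt]

theorem qInt_succ (q : ℂ) (n : ℕ) : qInt q (n + 1) = qInt q n + q ^ n := by
  simp [qInt, sum_range_succ]

theorem qInt_add (q : ℂ) (m n : ℕ) : qInt q (m + n) = qInt q m + q ^ m * qInt q n := by
  simp only [qInt, sum_range_add, mul_sum, pow_add]

theorem qInt_succ' (q : ℂ) (n : ℕ) : qInt q (n + 1) = q * qInt q n + 1 := by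
  rw [add_comm, qInt_add, qInt_one]
  ring

/-- The `q`-factorial `[n]! = [1] [2] ⋯ [n]`. -/
noncomputable def qFact (q : ℂ) (n : ℕ) : ℂ := ∏ i ∈ range n, qInt q (i + 1)

@[simp] theorem qFact_zero (q : ℂ) : qFact q 0 = 1 := by simp [qFact]

theorem qFact_succ (q : ℂ) (n : ℕ) : qFact q (n + 1) = qInt q (n + 1) * qFact q n := by
  rw [qFact, prod_range_succ, mul_comm, qFact]

theorem qFact_ne_zero {q : ℂ} {k : ℕ} (hq : ∀ n : ℕ, 1 ≤ n → n ≤ k → qInt q n ≠ 0) {n : ℕ}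
    (hn : n ≤ k) : qFact q n ≠ 0 :=
  prod_ne_zero_iff.mpr fun i hi => hq _ (by omega) (by have := mem_range.mp hi; omega)

/-- The `q`-binomial coefficients. -/
noncomputable def qBinom (q : ℂ) : ℕ → ℕ → ℂ
  | _, 0 => 1
  | 0, _ + 1 => 0
  | n + 1, m + 1 => q ^ (m + 1) * qBinom q n (m + 1) + qBinom q n m

@[simp] theorem qBinom_zero_right (q : ℂ) (n : ℕ) : qBinom q n 0 = 1 := by
  cases n <;> simp [qBinom]

theorem qBinom_succ_succ (q : ℂ) (n m : ℕ) :
    qBinom q (n + 1) (m + 1) = q ^ (m + 1) * qBinom q n (m + 1) + qBinom q n m := by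
  simp [qBinom]

theorem qBinom_eq_zero (q : ℂ) {n m : ℕ} (h : n < m) : qBinom q n m = 0 := by
  induction n generalizing m with
  | zero => obtain ⟨m, rfl⟩ := Nat.exists_eq_succ_of_ne_zero h.ne'; simp [qBinom]
  | succ n ih =>
    obtain ⟨m, rfl⟩ := Nat.exists_eq_succ_of_ne_zero (Nat.ne_zero_of_lt h)
    rw [Nat.succ_eq_add_one, qBinom_succ_succ, ih (by omega), ih (by omega)]
    simp

@[simp] theorem qBinom_self (q : ℂ) (n : ℕ) : qBinom q n n = 1 := by
  induction n with
  | zero => simp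
  | succ n ih => rw [qBinom_succ_succ, ih, qBinom_eq_zero q (Nat.lt_succ_self n)]; simp

theorem qBinom_add_succ (q : ℂ) (i j : ℕ) :
    qBinom q (i + j + 1) (j + 1) = qBinom q (i + j) (j + 1) + q ^ i * qBinom q (i + j) j := by
  induction i generalizing j with
  | zero => simp [qBinom_eq_zero]
  | succ i ih =>
    induction j with
    | zero =>
      have h := ih 0
      have h1 := qBinom_succ_succ q (i + 1) 0
      have h2 := qBinom_succ_succ q i 0
      simp only [add_zero, zero_add, qBinom_zero_right] at *
      rw [h1]
      linear_combination q * h - h2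
    | succ j ihj =>
      have h1 := ih (j + 1)
      have h2 := qBinom_succ_succ q (i + 1 + (j + 1)) (j + 1)
      have h3 := qBinom_succ_succ q (i + 1 + j) (j + 1)
      have h4 := qBinom_succ_succ q (i + 1 + j) j
      have e1 : i + 1 + (j + 1) = i + 1 + j + 1 := by ring
      have e2 : i + (j + 1) = i + 1 + j := by ring
      rw [e1] at *
      rw [e2] at h1
      linear_combination h2 + q ^ (j + 2) * h1 + ihj - h3 - q ^ (i + 1) * h4

theorem qBinom_succ_succ' (q : ℂ) {n m : ℕ} (h : m ≤ n) :
    qBinom q (n + 1) (m + 1) = qBinom q n (m + 1) + q ^ (n - m) * qBinom q n m := by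
  obtain ⟨i, rfl⟩ := Nat.exists_eq_add_of_le' h
  rw [qBinom_add_succ, Nat.add_sub_cancel]

theorem qBinom_mul_qFact (q : ℂ) (i j : ℕ) :
    qBinom q (i + j) j * (qFact q i * qFact q j) = qFact q (i + j) := by
  induction i generalizing j with
  | zero => simp
  | succ i ih =>
    induction j with
    | zero => simp
    | succ j ihj =>
      have h1 := ih (j + 1)
      have e1 : i + 1 + (j + 1) = i + 1 + j + 1 := by ring
      have e2 : i + (j + 1) = i + 1 + j := by ring
      rw [e2] at h1
      rw [e1, qBinom_succ_succ]
      have h3 : qInt q (i + 1 + j + 1) = qInt q (j + 1) + q ^ (j + 1) * qInt q (i + 1) := by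
        rw [← qInt_add]; congr 1; ring
      rw [qFact_succ q (i + 1 + j), h3]
      rw [qFact_succ q i] at *
      rw [qFact_succ q j] at *
      linear_combination q ^ (j + 1) * qInt q (i + 1) * h1 + qInt q (j + 1) * ihj

/-- The product of the numbers `1 + s [i]` for `i < n`. -/
noncomputable def rateDen (s q : ℂ) (n : ℕ) : ℂ := ∏ i ∈ range n, (1 + s * qInt q i)

theorem rateDen_succ (s q : ℂ) (n : ℕ) :
    rateDen s q (n + 1) = rateDen s q n * (1 + s * qInt q n) := prod_range_succ _ _

theorem rateDen_ne_zero {s q : ℂ} {k : ℕ}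
    (hs : ∀ n : ℕ, 1 ≤ n → n < k → 1 + s * qInt q n ≠ 0) {n : ℕ} (hn : n ≤ k) :
    rateDen s q n ≠ 0 := by
  refine prod_ne_zero_iff.mpr fun i hi => ?_
  rcases Nat.eq_zero_or_pos i with rfl | h
  · simp
  · exact hs _ h (by have := mem_range.mp hi; omega)

/-- A `q`-Vandermonde identity. -/
theorem prod_one_add_mul_qInt (s q : ℂ) (m n : ℕ) :
    ∏ i ∈ range n, (1 + s * qInt q (m + i)) =
      ∑ j ∈ range (n + 1), qBinom q n j * s ^ j * (∏ i ∈ range j, qInt q (m + i)) *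
        rateDen s q (n - j) := by
  induction n with
  | zero => simp [rateDen]
  | succ n ih =>
    rw [prod_range_succ, ih, sum_mul, sum_range_succ' _ (n + 1)]
    have h1 : ∀ j ∈ range (n + 1), qBinom q (n + 1) (j + 1) * s ^ (j + 1) *
        (∏ i ∈ range (j + 1), qInt q (m + i)) * rateDen s q (n + 1 - (j + 1)) =
        qBinom q n (j + 1) * s ^ (j + 1) *
        (∏ i ∈ range (j + 1), qInt q (m + i)) * rateDen s q (n + 1 - (j + 1)) +
        q ^ (n - j) * qBinom q n j * s ^ (j + 1) *
        (∏ i ∈ range (j + 1), qInt q (m + i)) * rateDen s q (n - j) := by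
      intro j hj
      rw [qBinom_succ_succ' q (by have := mem_range.mp hj; omega), Nat.add_sub_add_right]
      ring
    rw [sum_congr rfl h1, sum_add_distrib]
    have h2 := sum_range_succ' (fun j => qBinom q n j * s ^ j *
        (∏ i ∈ range j, qInt q (m + i)) * rateDen s q (n + 1 - j)) (n + 1)
    rw [sum_range_succ, qBinom_eq_zero q (Nat.lt_succ_self n)] at h2
    simp only [qBinom_zero_right] at h2 ⊢
    rw [add_right_comm, ← h2]
    simp only [zero_mul, add_zero]
    rw [← sum_add_distrib]
    refine sum_congr rfl fun j hj => ?_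
    have hj' : j ≤ n := by have := mem_range.mp hj; omega
    have h3 : qInt q (m + n) = qInt q (n - j) + q ^ (n - j) * qInt q (m + j) := by
      rw [← qInt_add]; congr 1; omega
    rw [h3, Nat.succ_sub hj', Nat.succ_eq_add_one, rateDen_succ, prod_range_succ]
    ring

theorem prod_qInt_sub_mul (q : ℂ) {c r : ℕ} (h : r ≤ c) :
    (∏ p ∈ range r, qInt q (c - p)) * qFact q (c - r) = qFact q c := by
  induction r with
  | zero => simp
  | succ r ih =>
    rw [← ih (by omega), prod_range_succ, mul_assoc]
    have e : c - r = c - (r + 1) + 1 := by omega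
    rw [e, ← qFact_succ]

theorem prod_one_add_sub_mul (s q : ℂ) {c r : ℕ} (h : r ≤ c) :
    (∏ p ∈ range r, (1 + s * qInt q (c - 1 - p))) * rateDen s q (c - r) = rateDen s q c := by
  induction r with
  | zero => simp
  | succ r ih =>
    rw [← ih (by omega), prod_range_succ, mul_assoc]
    have e : c - r = c - (r + 1) + 1 := by omega
    have e' : c - 1 - r = c - (r + 1) := by omega
    rw [e, e', rateDen_succ]
    ring

theorem rate_eq {s q : ℂ} {k : ℕ}
    (hq : ∀ n : ℕ, 1 ≤ n → n ≤ k → qInt q n ≠ 0)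
    (hs : ∀ n : ℕ, 1 ≤ n → n < k → 1 + s * qInt q n ≠ 0)
    {c r : ℕ} (h : r ≤ c) (hc : c ≤ k) :
    rate s q c r = s ^ (r - 1) / qInt q r * (qFact q c / qFact q (c - r)) *
      (rateDen s q (c - r) / rateDen s q c) := by
  have h1 := qFact_ne_zero hq (n := c - r) (by omega)
  have h2 := rateDen_ne_zero hs (n := c - r) (by omega)
  have h3 := rateDen_ne_zero hs hc
  have h4 := prod_one_add_sub_mul s q h
  have h5 : (∏ p ∈ range r, (1 + s * qInt q (c - 1 - p))) ≠ 0 := by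
    intro h0; rw [h0, zero_mul] at h4; exact h3 h4.symm
  rw [rate, prod_div_distrib, ← prod_qInt_sub_mul q h, ← h4]
  field_simp

theorem sum_rate_mul {s q : ℂ} {k : ℕ}
    (hq : ∀ n : ℕ, 1 ≤ n → n ≤ k → qInt q n ≠ 0)
    (hs : ∀ n : ℕ, 1 ≤ n → n < k → 1 + s * qInt q n ≠ 0)
    {c m : ℕ} (hm : m + 1 ≤ c) (hc : c ≤ k) :
    ∑ r ∈ Icc 1 c, rate s q c r * (qBinom q r (m + 1) * rateDen s q (m + 1)) =
      s ^ m * qFact q m * qBinom q c (m + 1) := by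
  obtain ⟨n, rfl⟩ := Nat.exists_eq_add_of_le' hm
  have hsub : Icc (m + 1) (n + (m + 1)) ⊆ Icc 1 (n + (m + 1)) := Icc_subset_Icc_left (by omega)
  rw [← sum_subset hsub (fun r h1 h2 => by
    rw [qBinom_eq_zero q (by simp only [mem_Icc] at h1 h2; omega)]; ring)]
  have hI : Icc (m + 1) (n + (m + 1)) = (range (n + 1)).image (· + (m + 1)) := by
    ext r; simp only [mem_Icc, mem_image, mem_range]
    exact ⟨fun h => ⟨r - (m + 1), by omega, by omega⟩, fun ⟨a, h⟩ => by omega⟩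
  rw [hI, sum_image (by intro a _ b _ h; exact Nat.add_right_cancel h)]
  have hV := prod_one_add_mul_qInt s q (m + 1) n
  have hP : rateDen s q (m + 1) * ∏ i ∈ range n, (1 + s * qInt q (m + 1 + i)) =
      rateDen s q (n + (m + 1)) := by
    rw [add_comm n]
    exact (prod_range_add _ _ _).symm
  have h0 := rateDen_ne_zero hs hc
  have hm1 := qFact_ne_zero hq (n := m + 1) (by omega)
  have hm0 := qFact_ne_zero hq (n := m) (by omega)
  have hn := qFact_ne_zero hq (n := n) (by omega)
  have key : ∀ j ∈ range (n + 1), rate s q (n + (m + 1)) (j + (m + 1)) *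
      (qBinom q (j + (m + 1)) (m + 1) * rateDen s q (m + 1)) =
      s ^ m * qFact q m * qBinom q (n + (m + 1)) (m + 1) *
      (rateDen s q (m + 1) / rateDen s q (n + (m + 1))) *
      (qBinom q n j * s ^ j * (∏ i ∈ range j, qInt q (m + 1 + i)) * rateDen s q (n - j)) := by
    intro j hj
    have hj' : j ≤ n := by have := mem_range.mp hj; omega
    rw [rate_eq hq hs (by omega) hc]
    have e1 : n + (m + 1) - (j + (m + 1)) = n - j := by omega
    have e2 : j + (m + 1) - 1 = m + j := by omega
    rw [e1, e2]
    have hj1 := qFact_ne_zero hq (n := j) (by omega)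
    have hnj := qFact_ne_zero hq (n := n - j) (by omega)
    have hjm := hq (j + (m + 1)) (by omega) (by omega)
    have b1 := eq_div_of_mul_eq (mul_ne_zero hj1 hm1) (qBinom_mul_qFact q j (m + 1))
    have b2 := eq_div_of_mul_eq (mul_ne_zero hn hm1) (qBinom_mul_qFact q n (m + 1))
    have b3 := qBinom_mul_qFact q (n - j) j
    rw [Nat.sub_add_cancel hj'] at b3
    have b3 := eq_div_of_mul_eq (mul_ne_zero hnj hj1) b3
    have b4 : qFact q m * ∏ i ∈ range j, qInt q (m + 1 + i) = qFact q (m + j) := by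
      rw [qFact, qFact, prod_range_add]
      simp only [add_right_comm]
    have b4 := eq_div_of_mul_eq hm0 ((mul_comm _ _).trans b4)
    have b5 : qFact q (j + (m + 1)) = qInt q (j + (m + 1)) * qFact q (m + j) := by
      rw [← add_assoc, qFact_succ, add_comm j m]
    rw [b1, b2, b3, b4, b5]
    field_simp
    ring
  rw [sum_congr rfl key, ← mul_sum, ← hV, mul_assoc, div_mul_eq_mul_div, hP, div_self h0, mul_one]

/-! ### The value of the symmetrized scattering factor -/

section Polynomial

open Polynomial

/-- A polynomial interpolating `∏_{j ≠ i} (q z_j - z_i)`, with leading coefficient `[n]`. -/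
theorem exists_interpolating_poly {ι : Type*} [DecidableEq ι] (q : ℂ) (z : ι → ℂ) (t : Finset ι) :
    ∃ P : ℂ[X], P.degree < (#t : ℕ) ∧ P.coeff (#t - 1) = qInt q #t ∧
      ∀ i ∈ t, P.eval (z i) = ∏ j ∈ t.erase i, (q * z i - z j) := by
  induction t using Finset.induction_on with
  | empty => exact ⟨0, by simp, by simp, by simp⟩
  | insert a t ha ih =>
    obtain ⟨P, hd, hc, he⟩ := ih
    have hR : ∀ u : Finset ι, (∏ j ∈ u, (C q * X - C (z j))).degree ≤ ((#u : ℕ) : WithBot ℕ) ∧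
        (∏ j ∈ u, (C q * X - C (z j))).coeff #u = q ^ #u := by
      intro u
      have h1 : ∀ j ∈ u, (C q * X - C (z j)).natDegree ≤ 1 := by
        intro j _
        compute_degree
      refine ⟨?_, ?_⟩
      · refine degree_le_of_natDegree_le ((natDegree_prod_le _ _).trans ?_)
        simpa using sum_le_sum h1
      · have := coeff_prod_of_natDegree_le (s := u) (fun j => C q * X - C (z j)) 1 h1
        rw [mul_one] at this
        rw [this]
        simp [coeff_C]
    obtain ⟨hRd, hRc⟩ := hR t
    refine ⟨(X - C (z a)) * P + ∏ j ∈ t, (C q * X - C (z j)), ?_, ?_, ?_⟩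
    · rw [card_insert_of_notMem ha]
      have hP : P.degree + 1 ≤ (#t : ℕ) := by
        by_cases hP0 : P = 0
        · simp [hP0]
        · rw [degree_eq_natDegree hP0] at hd ⊢
          exact_mod_cast Nat.succ_le_of_lt (by exact_mod_cast hd)
      refine lt_of_le_of_lt (degree_add_le_of_degree_le (n := #t) ?_ hRd) ?_
      · rw [degree_mul, degree_X_sub_C, add_comm]
        exact hP
      · exact_mod_cast Nat.lt_succ_self _
    · rw [card_insert_of_notMem ha, Nat.add_sub_cancel, coeff_add, hRc, qInt_succ, ← hc]
      congr 1
      rcases Nat.eq_zero_or_pos #t with h0 | h0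
      · have : P = 0 := by
          rw [h0] at hd
          exact degree_eq_bot.mp (by simpa using hd)
        simp [this]
      · obtain ⟨n, hn⟩ := Nat.exists_eq_succ_of_ne_zero h0.ne'
        rw [hn, Nat.succ_eq_add_one, sub_mul, coeff_sub, coeff_X_mul, coeff_C_mul,
          coeff_eq_zero_of_degree_lt (n := n + 1) (by rw [hn] at hd; exact hd)]
        simp
    · intro i hi
      rw [eval_add, eval_mul, eval_prod]
      simp only [eval_sub, eval_mul, eval_X, eval_C]
      rcases mem_insert.mp hi with rfl | hi
      · rw [erase_insert ha]
        simp
      · have hia : i ≠ a := fun h => ha (h ▸ hi)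
        rw [he i hi, erase_insert_of_ne hia.symm, prod_insert (by simp [ha]),
          ← mul_prod_erase t _ hi]
        ring

end Polynomial

theorem sum_prod_div_eq_qInt {ι : Type*} [DecidableEq ι] (q : ℂ) {z : ι → ℂ}
    (hz : Function.Injective z) (t : Finset ι) :
    ∑ i ∈ t, ∏ j ∈ t.erase i, (q * z i - z j) / (z i - z j) = qInt q #t := by
  obtain ⟨P, hd, hc, he⟩ := exists_interpolating_poly q z t
  rw [← hc, Lagrange.coeff_eq_sum hz.injOn hd]
  exact sum_congr rfl fun i hi => by rw [prod_div_distrib, he i hi]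

/-- The scattering factor `∏_{i < j} (q z_i - z_j) / (z_i - z_j)`. -/
noncomputable def scattering {k : ℕ} (q : ℂ) (z : Fin k → ℂ) : ℂ :=
  ∏ i : Fin k, ∏ j ∈ Ioi i, (q * z i - z j) / (z i - z j)

theorem scattering_succ {k : ℕ} (q : ℂ) (z : Fin (k + 1) → ℂ) :
    scattering q z = (∏ j : Fin k, (q * z 0 - z j.succ) / (z 0 - z j.succ)) *
      scattering q (fun i => z i.succ) := by
  rw [scattering, Fin.prod_univ_succ, Fin.prod_Ioi_zero]
  simp only [Fin.prod_Ioi_succ]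
  rfl

theorem sum_scattering {k : ℕ} (q : ℂ) {z : Fin k → ℂ} (hz : Function.Injective z) :
    ∑ σ : Equiv.Perm (Fin k), scattering q (z ∘ σ) = qFact q k := by
  induction k with
  | zero => simp [scattering]
  | succ k ih =>
    rw [← Equiv.Perm.decomposeFin.symm.sum_comp, Fintype.sum_prod_type]
    have key : ∀ p : Fin (k + 1), ∑ e : Equiv.Perm (Fin k),
        scattering q (z ∘ Equiv.Perm.decomposeFin.symm (p, e)) =
        (∏ j ∈ univ.erase p, (q * z p - z j) / (z p - z j)) * qFact q k := by
      intro p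
      have hz' : Function.Injective fun i : Fin k => z (Equiv.swap 0 p i.succ) :=
        hz.comp ((Equiv.injective _).comp (Fin.succ_injective k))
      rw [← ih hz', mul_sum]
      refine sum_congr rfl fun e _ => ?_
      rw [scattering_succ]
      simp only [Function.comp_apply, Equiv.Perm.decomposeFin_symm_apply_zero,
        Equiv.Perm.decomposeFin_symm_apply_succ]
      congr 1
      rw [Equiv.prod_comp e (fun j : Fin k => (q * z p - z (Equiv.swap 0 p j.succ)) /
        (z p - z (Equiv.swap 0 p j.succ)))]
      refine prod_bij (fun j _ => Equiv.swap 0 p j.succ) ?_ ?_ ?_ ?_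
      · intro j _
        simp only [mem_erase, mem_univ, and_true]
        intro h
        have : j.succ = 0 := by
          exact (Equiv.swap 0 p).injective (h.trans (Equiv.swap_apply_left 0 p).symm)
        exact Fin.succ_ne_zero j this
      · intro a _ b _ h
        exact Fin.succ_injective k ((Equiv.swap 0 p).injective h)
      · intro b hb
        have hb : b ≠ p := (mem_erase.mp hb).1
        have : Equiv.swap 0 p b ≠ 0 := by
          intro h
          exact hb ((Equiv.swap 0 p).injective (h.trans (Equiv.swap_apply_right 0 p).symm))
        obtain ⟨j, hj⟩ := Fin.exists_succ_eq.mpr this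
        exact ⟨j, mem_univ _, by rw [hj, Equiv.swap_apply_self]⟩
      · intro _ _
        rfl
    rw [sum_congr rfl fun p _ => key p, ← sum_mul, sum_prod_div_eq_qInt q hz, card_univ,
      Fintype.card_fin, ← qFact_succ]

/-! ### Functions of a sequence modulo the exchange relation -/

/-- The product `y_a y_{a+1} ⋯ y_{a+m-1}`, as a function of the sequence `y`. -/
noncomputable def mon (a m : ℕ) (y : ℕ → ℂ) : ℂ := ∏ i ∈ range m, y (a + i)

@[simp] theorem mon_zero (a : ℕ) : mon a 0 = 1 := by funext y; simp [mon]

theorem mon_succ (a m : ℕ) (y : ℕ → ℂ) : mon a (m + 1) y = mon a m y * y (a + m) :=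
  prod_range_succ _ _

/-- The polynomial `q y_{i+1} - y_i + s y_i y_{i+1}`. -/
noncomputable def exchangeRel (s q : ℂ) (i : ℕ) (y : ℕ → ℂ) : ℂ :=
  q * y (i + 1) - y i + s * (y i * y (i + 1))

/-- The functions of a sequence that are symmetric in its entries of index `p ≤ i < n`. -/
def IsSymmOn (p n : ℕ) (H : (ℕ → ℂ) → ℂ) : Prop :=
  ∀ i, p ≤ i → i + 1 < n → ∀ y, H (y ∘ Equiv.swap i (i + 1)) = H y

/-- The span of the multiples of the polynomials `exchangeRel s q i` by the functions that are
symmetric in the entries `i` and `i + 1`, for `p ≤ i < i + 1 < n`. -/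
def exchange (s q : ℂ) (p n : ℕ) : Submodule ℂ ((ℕ → ℂ) → ℂ) :=
  Submodule.span ℂ {G | ∃ i, p ≤ i ∧ i + 1 < n ∧ ∃ H : (ℕ → ℂ) → ℂ,
    (∀ y, H (y ∘ Equiv.swap i (i + 1)) = H y) ∧ G = H * exchangeRel s q i}

theorem exchange_mono (s q : ℂ) (p : ℕ) {n n' : ℕ} (h : n ≤ n') :
    exchange s q p n ≤ exchange s q p n' := by
  refine Submodule.span_mono ?_
  rintro G ⟨i, hi, hn, H, hH, rfl⟩
  exact ⟨i, hi, by omega, H, hH, rfl⟩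

theorem mul_mem_exchange {s q : ℂ} {p n : ℕ} {G K : (ℕ → ℂ) → ℂ} (hG : G ∈ exchange s q p n)
    (hK : IsSymmOn p n K) : G * K ∈ exchange s q p n := by
  refine Submodule.span_induction (p := fun G _ => G * K ∈ exchange s q p n) ?_ ?_ ?_ ?_ hG
  · rintro G ⟨i, hi, hn, H, hH, rfl⟩
    refine Submodule.subset_span ⟨i, hi, hn, H * K, fun y => ?_, mul_right_comm _ _ _⟩
    simp only [Pi.mul_apply, hH, hK i hi hn]
  · rw [zero_mul]; exact Submodule.zero_mem _
  · intro G₁ G₂ _ _ h₁ h₂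
    rw [add_mul]; exact Submodule.add_mem _ h₁ h₂
  · intro t G _ h
    rw [smul_mul_assoc]; exact Submodule.smul_mem _ _ h

theorem swap_apply_of_lt {i j : ℕ} (h : j < i) : Equiv.swap i (i + 1) j = j :=
  Equiv.swap_apply_of_ne_of_ne (by omega) (by omega)

theorem swap_apply_of_gt {i j : ℕ} (h : i + 1 < j) : Equiv.swap i (i + 1) j = j :=
  Equiv.swap_apply_of_ne_of_ne (by omega) (by omega)

theorem mon_mul_exchangeRel_mem {s q : ℂ} {p a m n : ℕ} (ha : p ≤ a) (hn : a + m + 1 < n) :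
    mon a m * exchangeRel s q (a + m) ∈ exchange s q p n := by
  refine Submodule.subset_span ⟨a + m, by omega, hn, mon a m, fun y => ?_, rfl⟩
  refine prod_congr rfl fun i hi => ?_
  rw [Function.comp_apply, swap_apply_of_lt (by have := mem_range.mp hi; omega)]

/-- Normal ordering: moving one empty slot through `m` factors. -/
theorem mon_sub_mem_exchange (s q : ℂ) {p a : ℕ} (ha : p ≤ a) (m : ℕ) :
    mon a m - (q ^ m • mon (a + 1) m + (s * qInt q m) • mon a (m + 1)) ∈
      exchange s q p (a + m + 1) := by
  induction m with
  | zero =>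
    convert Submodule.zero_mem _ using 1
    funext y
    simp
  | succ m ih =>
    have h1 : IsSymmOn p (a + m + 1) (fun y => y (a + m + 1)) := fun i _ hi y => by
      simp only [Function.comp_apply, swap_apply_of_gt hi]
    have h2 := Submodule.sub_mem _ (Submodule.smul_mem _ q
      (exchange_mono s q p (n' := a + (m + 1) + 1) (by omega) (mul_mem_exchange ih h1)))
      (mon_mul_exchangeRel_mem (s := s) (q := q) ha (Nat.lt_succ_self (a + m + 1)))
    convert h2 using 1
    funext y
    have e1 := mon_succ (a + 1) m y
    have e2 : a + 1 + m = a + m + 1 := by ring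
    rw [e2] at e1
    simp only [Pi.sub_apply, Pi.add_apply, Pi.smul_apply, Pi.mul_apply, smul_eq_mul, exchangeRel,
      e1, mon_succ, qInt_succ', ← add_assoc]
    ring

theorem prod_one_add_sub_mem_exchange (s q : ℂ) {p a : ℕ} (ha : p ≤ a) (r : ℕ) :
    (fun y => ∏ i ∈ range r, (1 + y (a + i))) -
      ∑ m ∈ range (r + 1), (qBinom q r m * rateDen s q m) • mon (a + r - m) m ∈
      exchange s q p (a + r) := by
  induction r with
  | zero =>
    convert Submodule.zero_mem _ using 1
    funext y
    simp [rateDen]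
  | succ r ih =>
    have h1 : IsSymmOn p (a + r) (fun y => 1 + y (a + r)) := fun i _ hi y => by
      simp only [Function.comp_apply, swap_apply_of_gt hi]
    have h2 : ∀ m ∈ range (r + 1), (qBinom q r m * rateDen s q m) •
        (mon (a + r - m) m - (q ^ m • mon (a + r - m + 1) m +
          (s * qInt q m) • mon (a + r - m) (m + 1))) ∈ exchange s q p (a + (r + 1)) := by
      intro m hm
      have hm' := mem_range.mp hm
      have e : a + (r + 1) = a + r - m + m + 1 := by omega
      rw [e]
      exact Submodule.smul_mem _ _ (mon_sub_mem_exchange s q (by omega) m)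
    have h3 := Submodule.add_mem _ (exchange_mono s q p (n' := a + (r + 1)) (by omega) (mul_mem_exchange ih h1))
      (Submodule.sum_mem _ h2)
    convert h3 using 1
    funext y
    have hN : ∑ m ∈ range (r + 1 + 1), qBinom q (r + 1) m * rateDen s q m *
        mon (a + (r + 1) - m) m y =
        ∑ m ∈ range (r + 1), (qBinom q r m * rateDen s q m * (q ^ m * mon (a + r - m + 1) m y) +
          qBinom q r m * rateDen s q m * ((1 + s * qInt q m) * mon (a + r - m) (m + 1) y)) := by
      have h4 := sum_range_succ' (fun m => q ^ m * qBinom q r m * rateDen s q m *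
        mon (a + (r + 1) - m) m y) (r + 1)
      rw [sum_range_succ, qBinom_eq_zero q (Nat.lt_succ_self r)] at h4
      simp only [mul_zero, zero_mul, add_zero] at h4
      rw [sum_range_succ', sum_add_distrib]
      have h5 : ∑ m ∈ range (r + 1), qBinom q r m * rateDen s q m *
          (q ^ m * mon (a + r - m + 1) m y) = ∑ m ∈ range (r + 1), q ^ m * qBinom q r m *
          rateDen s q m * mon (a + (r + 1) - m) m y := by
        refine sum_congr rfl fun m hm => ?_
        have e : a + (r + 1) - m = a + r - m + 1 := by have := mem_range.mp hm; omega
        rw [e]; ring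
      rw [h5, h4, add_right_comm, ← sum_add_distrib]
      congr 1
      · refine sum_congr rfl fun m _ => ?_
        have e : a + (r + 1) - (m + 1) = a + r - m := by omega
        rw [e, qBinom_succ_succ, rateDen_succ]
        ring
      · simp
    simp only [Pi.sub_apply, Pi.add_apply, Pi.smul_apply, Pi.mul_apply, smul_eq_mul,
      Finset.sum_apply]
    rw [hN, prod_range_succ, sub_mul, sum_mul, sub_add, ← sum_sub_distrib]
    congr 1
    refine sum_congr rfl fun m hm => ?_
    have e : a + r - m + m = a + r := by have := mem_range.mp hm; omega
    rw [mon_succ, e]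
    ring

theorem sum_sub_mem_exchange (s q : ℂ) {p a : ℕ} (ha : p ≤ a) (n : ℕ) :
    (fun y => ∑ i ∈ range n, y (a + i)) -
      ∑ m ∈ range n, (s ^ m * qFact q m * qBinom q n (m + 1)) • mon (a + n - (m + 1)) (m + 1) ∈
      exchange s q p (a + n) := by
  induction n with
  | zero =>
    convert Submodule.zero_mem _ using 1
    funext y
    simp
  | succ n ih =>
    have h2 : ∀ m ∈ range n, (s ^ m * qFact q m * qBinom q n (m + 1)) •
        (mon (a + n - (m + 1)) (m + 1) - (q ^ (m + 1) • mon (a + n - (m + 1) + 1) (m + 1) +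
          (s * qInt q (m + 1)) • mon (a + n - (m + 1)) (m + 1 + 1))) ∈
        exchange s q p (a + (n + 1)) := by
      intro m hm
      have hm' := mem_range.mp hm
      have e : a + (n + 1) = a + n - (m + 1) + (m + 1) + 1 := by omega
      rw [e]
      exact Submodule.smul_mem _ _ (mon_sub_mem_exchange s q (by omega) (m + 1))
    have h3 := Submodule.add_mem _ (exchange_mono s q p (n' := a + (n + 1)) (by omega) ih)
      (Submodule.sum_mem _ h2)
    convert h3 using 1
    funext y
    have hN : ∑ m ∈ range (n + 1), s ^ m * qFact q m * qBinom q (n + 1) (m + 1) *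
        mon (a + (n + 1) - (m + 1)) (m + 1) y =
        y (a + n) + ∑ m ∈ range n, (s ^ m * qFact q m * qBinom q n (m + 1)) *
          (q ^ (m + 1) * mon (a + n - (m + 1) + 1) (m + 1) y +
          s * qInt q (m + 1) * mon (a + n - (m + 1)) (m + 1 + 1) y) := by
      have h4 : ∑ m ∈ range (n + 1), s ^ m * qFact q m * (q ^ (m + 1) * qBinom q n (m + 1)) *
          mon (a + (n + 1) - (m + 1)) (m + 1) y = ∑ m ∈ range n,
          (s ^ m * qFact q m * qBinom q n (m + 1)) *
          (q ^ (m + 1) * mon (a + n - (m + 1) + 1) (m + 1) y) := by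
        rw [sum_range_succ, qBinom_eq_zero q (Nat.lt_succ_self n)]
        simp only [mul_zero, zero_mul, add_zero]
        refine sum_congr rfl fun m hm => ?_
        have e : a + (n + 1) - (m + 1) = a + n - (m + 1) + 1 := by
          have := mem_range.mp hm; omega
        rw [e]; ring
      have h5 : ∑ m ∈ range (n + 1), s ^ m * qFact q m * qBinom q n m *
          mon (a + (n + 1) - (m + 1)) (m + 1) y = y (a + n) + ∑ m ∈ range n,
          (s ^ m * qFact q m * qBinom q n (m + 1)) *
          (s * qInt q (m + 1) * mon (a + n - (m + 1)) (m + 1 + 1) y) := by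
        rw [sum_range_succ', add_comm]
        congr 1
        · simp [mon]
        · refine sum_congr rfl fun m hm => ?_
          have e : a + (n + 1) - (m + 1 + 1) = a + n - (m + 1) := by omega
          rw [e, qFact_succ]; ring
      simp only [mul_add]
      rw [sum_add_distrib, add_left_comm (y (a + n)), ← h5, ← h4, ← sum_add_distrib]
      refine sum_congr rfl fun m _ => ?_
      rw [qBinom_succ_succ]; ring
    simp only [Pi.sub_apply, Pi.add_apply, Pi.smul_apply, smul_eq_mul,
      Finset.sum_apply]
    rw [hN, sum_range_succ]
    simp only [mul_sub, sum_sub_distrib]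
    ring

/-- For a cluster occupying the indices `p ≤ i < p + c`, the interacting generator agrees with the
free one modulo the exchange relations. -/
theorem sum_rate_sub_mem_exchange {s q : ℂ} {k : ℕ}
    (hq : ∀ n : ℕ, 1 ≤ n → n ≤ k → qInt q n ≠ 0)
    (hs : ∀ n : ℕ, 1 ≤ n → n < k → 1 + s * qInt q n ≠ 0) (p : ℕ) {c : ℕ} (hc : c ≤ k) :
    (∑ r ∈ Icc 1 c, rate s q c r • fun y : ℕ → ℂ => ∏ i ∈ range r, (1 + y (p + c - r + i)) - 1) -
      (fun y => ∑ i ∈ range c, y (p + i)) ∈ exchange s q p (p + c) := by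
  have h1 : ∀ r ∈ Icc 1 c, rate s q c r • ((fun y : ℕ → ℂ =>
      ∏ i ∈ range r, (1 + y (p + c - r + i))) -
      ∑ m ∈ range (r + 1), (qBinom q r m * rateDen s q m) • mon (p + c - m) m) ∈
      exchange s q p (p + c) := by
    intro r hr
    have hr' := mem_Icc.mp hr
    have h := prod_one_add_sub_mem_exchange s q (p := p) (a := p + c - r) (by omega) r
    have e : p + c - r + r = p + c := by omega
    rw [e] at h
    exact Submodule.smul_mem _ _ h
  convert Submodule.sub_mem _ (Submodule.sum_mem _ h1) (sum_sub_mem_exchange s q le_rfl c) using 1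
  funext y
  simp only [Pi.sub_apply, Pi.smul_apply, smul_eq_mul, Finset.sum_apply]
  have h2 : ∀ r ∈ Icc 1 c, ∑ m ∈ range (r + 1), qBinom q r m * rateDen s q m *
      mon (p + c - m) m y = 1 + ∑ m ∈ range c, qBinom q r (m + 1) * rateDen s q (m + 1) *
      mon (p + c - (m + 1)) (m + 1) y := by
    intro r hr
    have hr' := mem_Icc.mp hr
    rw [sum_range_succ', add_comm]
    congr 1
    · simp [rateDen]
    · refine sum_subset (range_mono hr'.2) fun m _ hm => ?_
      rw [qBinom_eq_zero q (by have := mem_range.not.mp hm; omega)]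
      ring
  have h3 : ∑ r ∈ Icc 1 c, rate s q c r * ∑ m ∈ range c, qBinom q r (m + 1) *
      rateDen s q (m + 1) * mon (p + c - (m + 1)) (m + 1) y = ∑ m ∈ range c,
      s ^ m * qFact q m * qBinom q c (m + 1) * mon (p + c - (m + 1)) (m + 1) y := by
    simp only [mul_sum]
    rw [sum_comm]
    refine sum_congr rfl fun m hm => ?_
    rw [← sum_rate_mul hq hs (Nat.succ_le_of_lt (mem_range.mp hm)) hc, sum_mul]
    exact sum_congr rfl fun r _ => by ring
  have h4 : ∀ r ∈ Icc 1 c, rate s q c r * (∏ i ∈ range r, (1 + y (p + c - r + i)) - 1) =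
      rate s q c r * (∏ i ∈ range r, (1 + y (p + c - r + i)) -
        ∑ m ∈ range (r + 1), qBinom q r m * rateDen s q m * mon (p + c - m) m y) +
      rate s q c r * ∑ m ∈ range c, qBinom q r (m + 1) * rateDen s q (m + 1) *
        mon (p + c - (m + 1)) (m + 1) y := by
    intro r hr
    rw [h2 r hr]
    ring
  rw [sum_congr rfl h4, sum_add_distrib, h3]
  ring

/-! ### Vanishing of the symmetrization of the exchange relations -/

theorem scattering_eq_prod_filter {k : ℕ} (q : ℂ) (v : Fin k → ℂ) :
    scattering q v = ∏ x : Fin k × Fin k with x.1 < x.2, (q * v x.1 - v x.2) / (v x.1 - v x.2) := by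
  rw [prod_filter, Fintype.prod_prod_type, scattering]
  refine prod_congr rfl fun i _ => ?_
  rw [← prod_filter]
  congr 1
  ext j
  simp

theorem swap_lt_swap {k : ℕ} {i j a b : Fin k} (hij : (j : ℕ) = i + 1) (hab : a < b)
    (hne : (a, b) ≠ (i, j)) : Equiv.swap i j a < Equiv.swap i j b ∧
      (Equiv.swap i j a, Equiv.swap i j b) ≠ (i, j) := by
  simp only [Equiv.swap_apply_def, ne_eq, Prod.mk.injEq, Fin.ext_iff, Fin.lt_def] at *
  split_ifs <;> omega

theorem scattering_adjacent {k : ℕ} (q : ℂ) {i j : Fin k} (hij : (j : ℕ) = i + 1) (v : Fin k → ℂ) :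
    ∃ R : ℂ, scattering q v = (q * v i - v j) / (v i - v j) * R ∧
      scattering q (v ∘ Equiv.swap i j) = (q * v j - v i) / (v j - v i) * R := by
  have hmem : (i, j) ∈ ({x : Fin k × Fin k | x.1 < x.2} : Finset _) := by
    simp only [mem_filter, mem_univ, true_and]
    omega
  refine ⟨∏ x ∈ ({x : Fin k × Fin k | x.1 < x.2} : Finset _).erase (i, j),
    (q * v x.1 - v x.2) / (v x.1 - v x.2), ?_, ?_⟩
  · rw [scattering_eq_prod_filter, ← mul_prod_erase _ _ hmem]
  · rw [scattering_eq_prod_filter, ← mul_prod_erase _ _ hmem]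
    simp only [Function.comp_apply, Equiv.swap_apply_left, Equiv.swap_apply_right]
    congr 1
    refine prod_bij' (fun x _ => (Equiv.swap i j x.1, Equiv.swap i j x.2))
      (fun x _ => (Equiv.swap i j x.1, Equiv.swap i j x.2)) ?_ ?_ ?_ ?_ ?_
    · intro x hx
      simp only [mem_erase, mem_filter, mem_univ, true_and] at hx ⊢
      exact (swap_lt_swap hij hx.2 hx.1).symm
    · intro x hx
      simp only [mem_erase, mem_filter, mem_univ, true_and] at hx ⊢
      exact (swap_lt_swap hij hx.2 hx.1).symm
    · simp
    · simp
    · simp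

/-- Extension of a finite sequence by zero. -/
noncomputable def extend {k : ℕ} (v : Fin k → ℂ) (n : ℕ) : ℂ := if h : n < k then v ⟨n, h⟩ else 0

@[simp] theorem extend_val {k : ℕ} (v : Fin k → ℂ) (i : Fin k) : extend v i = v i := by
  simp [extend]

theorem swap_val {k : ℕ} (i j m : Fin k) :
    Equiv.swap (i : ℕ) j m = (Equiv.swap i j m : Fin k) := by
  simp only [Equiv.swap_apply_def, Fin.ext_iff]
  split_ifs <;> rfl

theorem extend_comp_swap {k : ℕ} (v : Fin k → ℂ) (i j : Fin k) :
    extend (v ∘ Equiv.swap i j) = extend v ∘ Equiv.swap (i : ℕ) j := by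
  funext n
  by_cases h : n < k
  · obtain ⟨m, rfl⟩ : ∃ m : Fin k, (m : ℕ) = n := ⟨⟨n, h⟩, rfl⟩
    rw [extend_val, Function.comp_apply, Function.comp_apply, swap_val, extend_val]
  · have : Equiv.swap (i : ℕ) j n = n :=
      Equiv.swap_apply_of_ne_of_ne (by omega) (by omega)
    rw [Function.comp_apply, this]
    simp [extend, h]

/-- The eigenvalue contributed by a single spectral parameter. -/
noncomputable def energy (s q z : ℂ) : ℂ := (nu s q - 1) * z / (1 - nu s q * z)

theorem energy_exchange {s q : ℂ} (h : 1 - q + s ≠ 0) {z w : ℂ} (hz : 1 - nu s q * z ≠ 0)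
    (hw : 1 - nu s q * w ≠ 0) :
    q * energy s q w - energy s q z + s * (energy s q z * energy s q w) =
      (nu s q - 1) * (q * w - z) / ((1 - nu s q * z) * (1 - nu s q * w)) := by
  have hs : s * (nu s q - 1) = (q - 1) * nu s q := by
    rw [nu]; field_simp; ring
  rw [energy, energy]
  field_simp
  linear_combination (nu s q - 1) * z * w * hs

theorem one_add_energy {s q z : ℂ} (hz : 1 - nu s q * z ≠ 0) :
    1 + energy s q z = ((1 - nu s q * z) / (1 - z))⁻¹ := by
  rw [energy, inv_div]
  field_simp
  ring

theorem sum_scattering_mul_eq_zero {k : ℕ} {s q : ℂ} (hnu : 1 - q + s ≠ 0) {z : Fin k → ℂ}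
    (hz : Function.Injective z) (hznu : ∀ i, 1 - nu s q * z i ≠ 0) {p n : ℕ} (hn : n ≤ k)
    {G : (ℕ → ℂ) → ℂ} (hG : G ∈ exchange s q p n) :
    ∑ σ : Equiv.Perm (Fin k), scattering q (z ∘ σ) * G (extend (energy s q ∘ z ∘ σ)) = 0 := by
  refine Submodule.span_induction (p := fun G _ => ∑ σ : Equiv.Perm (Fin k),
    scattering q (z ∘ σ) * G (extend (energy s q ∘ z ∘ σ)) = 0) ?_ ?_ ?_ ?_ hG
  · rintro G ⟨i, hi, hin, H, hH, rfl⟩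
    obtain ⟨i', rfl⟩ : ∃ m : Fin k, (m : ℕ) = i := ⟨⟨i, by omega⟩, rfl⟩
    obtain ⟨j', hj⟩ : ∃ m : Fin k, (m : ℕ) = i' + 1 := ⟨⟨i' + 1, by omega⟩, rfl⟩
    rw [← self_eq_neg, ← sum_neg_distrib]
    rw [← Equiv.sum_comp (Equiv.mulRight (Equiv.swap i' j'))]
    refine sum_congr rfl fun σ _ => ?_
    have e1 : z ∘ (Equiv.mulRight (Equiv.swap i' j') σ) = (z ∘ σ) ∘ Equiv.swap i' j' := by
      funext m; simp
    obtain ⟨R, h1, h2⟩ := scattering_adjacent q hj (z ∘ σ)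
    rw [e1, ← Function.comp_assoc, extend_comp_swap, h1, h2, hj, Pi.mul_apply, Pi.mul_apply, hH]
    simp only [exchangeRel, Function.comp_apply, Equiv.swap_apply_left, Equiv.swap_apply_right]
    rw [← hj]
    simp only [extend_val, Function.comp_apply]
    have hne : z (σ i') - z (σ j') ≠ 0 := sub_ne_zero.mpr fun h => by
      have := congrArg Fin.val (σ.injective (hz h)); omega
    have hne' : z (σ j') - z (σ i') ≠ 0 := fun h => hne (by linear_combination -h)
    have hi1 := hznu (σ i')
    have hj1 := hznu (σ j')
    rw [energy_exchange hnu hi1 hj1, energy_exchange hnu hj1 hi1]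
    rw [← neg_sub (z (σ i')) (z (σ j')), div_neg]
    ring
  · simp
  · intro G₁ G₂ _ _ h₁ h₂
    simp only [Pi.add_apply, mul_add, sum_add_distrib, h₁, h₂, add_zero]
  · intro t G _ h
    simp only [Pi.smul_apply, smul_eq_mul, mul_left_comm _ t, ← mul_sum, h, mul_zero]

/-! ### Clusters -/

theorem mem_iff_lt_card {k : ℕ} {S : Finset (Fin k)} (hS : ∀ i ∈ S, ∀ j ≤ i, j ∈ S) (i : Fin k) :
    i ∈ S ↔ (i : ℕ) < #S := by
  constructor
  · intro hi
    have := card_le_card (fun j hj => hS i hi j (mem_Iic.mp hj) : Iic i ⊆ S)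
    rw [Fin.card_Iic] at this
    omega
  · intro hi
    by_contra h
    have : S ⊆ Iio i := fun j hj => mem_Iio.mpr (lt_of_not_ge fun hij => h (hS j hj i hij))
    have := card_le_card this
    rw [Fin.card_Iio] at this
    omega

theorem exists_cluster {k : ℕ} (x : Chamber k) (a : ℤ) : ∃ p : ℕ, p + clusterSize x a ≤ k ∧
    ∀ i : Fin k, x.1 i = a ↔ p ≤ (i : ℕ) ∧ (i : ℕ) < p + clusterSize x a := by
  have h1 := mem_iff_lt_card (S := {i : Fin k | a < x.1 i}) (fun i hi j hj => by
    simp only [mem_filter, mem_univ, true_and] at hi ⊢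
    exact hi.trans_le (x.2 hj))
  have h2 := mem_iff_lt_card (S := {i : Fin k | a ≤ x.1 i}) (fun i hi j hj => by
    simp only [mem_filter, mem_univ, true_and] at hi ⊢
    exact hi.trans (x.2 hj))
  have h3 : #{i : Fin k | a ≤ x.1 i} = #{i : Fin k | a < x.1 i} + clusterSize x a := by
    rw [clusterSize, ← card_union_of_disjoint]
    · congr 1
      ext i
      simp only [mem_filter, mem_univ, true_and, mem_union]
      omega
    · rw [disjoint_filter]
      intro i _ h; omega
  refine ⟨#{i : Fin k | a < x.1 i}, ?_, fun i => ?_⟩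
  · rw [← h3]
    exact (card_le_univ _).trans_eq (Fintype.card_fin k)
  · have h1 := h1 i
    have h2 := h2 i
    simp only [mem_filter, mem_univ, true_and] at h1 h2
    rw [← h3, ← h2, ← not_lt, ← h1]
    omega

@[to_additive]
theorem prod_range_eq_prod_filter {M : Type*} [CommMonoid M] {k b r : ℕ} (h : b + r ≤ k)
    (f : ℕ → M) : ∏ i ∈ range r, f (b + i) =
      ∏ i ∈ univ.filter (fun i : Fin k => b ≤ (i : ℕ) ∧ (i : ℕ) < b + r), f i := by
  refine prod_bij' (fun i hi => ⟨b + i, by have := mem_range.mp hi; omega⟩)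
    (fun i _ => i - b) ?_ ?_ ?_ ?_ ?_
  · intro i hi
    have := mem_range.mp hi
    simp only [mem_filter, mem_univ, true_and]
    omega
  · intro i hi
    simp only [mem_filter, mem_univ, true_and] at hi
    exact mem_range.mpr (by omega)
  · intro i _
    simp
  · intro i hi
    simp only [mem_filter, mem_univ, true_and] at hi
    simp only [Fin.ext_iff]
    omega
  · intro i _
    rfl

theorem card_filter_Ico {k b r : ℕ} (h : b + r ≤ k) :
    #(univ.filter fun i : Fin k => b ≤ (i : ℕ) ∧ (i : ℕ) < b + r) = r := by
  rw [card_eq_sum_ones, ← sum_range_eq_sum_filter h (fun _ => 1)]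
  simp

theorem lowered_iff {k : ℕ} {x : Chamber k} {a : ℤ} {p c r : ℕ} (hpc : p + c ≤ k) (hr : r ≤ c)
    (hx : ∀ i : Fin k, x.1 i = a ↔ p ≤ (i : ℕ) ∧ (i : ℕ) < p + c) (i : Fin k) :
    (x.1 i = a ∧ #{j : Fin k | i < j ∧ x.1 j = a} < r) ↔
      p + c - r ≤ (i : ℕ) ∧ (i : ℕ) < p + c - r + r := by
  by_cases hi : x.1 i = a
  · have hi' := (hx i).mp hi
    have hset : ({j : Fin k | i < j ∧ x.1 j = a} : Finset (Fin k)) =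
        univ.filter fun j : Fin k =>
          (i : ℕ) + 1 ≤ (j : ℕ) ∧ (j : ℕ) < (i : ℕ) + 1 + (p + c - 1 - i) := by
      ext j
      simp only [mem_filter, mem_univ, true_and, hx, Fin.lt_def]
      omega
    rw [hset, card_filter_Ico (by omega)]
    simp only [hi, true_and]
    omega
  · simp only [hi, false_and, false_iff]
    rw [hx] at hi
    omega

/-! ### The action of the generator -/

/-- The plane wave of `x`, as a function of the energies. -/
noncomputable def planeWave {k : ℕ} (x : Chamber k) (y : ℕ → ℂ) : ℂ :=
  ∏ i : Fin k, ((1 + y i)⁻¹) ^ x.1 i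

theorem planeWave_isSymmOn {k : ℕ} {x : Chamber k} {a : ℤ} {p c : ℕ} (hpc : p + c ≤ k)
    (hx : ∀ i : Fin k, x.1 i = a ↔ p ≤ (i : ℕ) ∧ (i : ℕ) < p + c) :
    IsSymmOn p (p + c) (planeWave x) := by
  intro i hi hic y
  obtain ⟨i', rfl⟩ : ∃ m : Fin k, (m : ℕ) = i := ⟨⟨i, by omega⟩, rfl⟩
  obtain ⟨j', hj⟩ : ∃ m : Fin k, (m : ℕ) = i' + 1 := ⟨⟨i' + 1, by omega⟩, rfl⟩
  rw [planeWave, planeWave, ← Equiv.prod_comp (Equiv.swap i' j')]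
  refine prod_congr rfl fun m _ => ?_
  have e1 : Equiv.swap (i' : ℕ) (i' + 1) (Equiv.swap i' j' m : Fin k) = m := by
    rw [← hj, swap_val, Equiv.swap_apply_self]
  have e2 : x.1 (Equiv.swap i' j' m) = x.1 m := by
    have hi' := (hx i').mpr ⟨by omega, by omega⟩
    have hj' := (hx j').mpr ⟨by omega, by omega⟩
    rw [Equiv.swap_apply_def]
    split_ifs with h1 h2
    · rw [h1, hi', hj']
    · rw [h2, hi', hj']
    · rfl
  rw [Function.comp_apply, e1, e2]

theorem planeWave_move {k : ℕ} {x : Chamber k} {a : ℤ} {p c r : ℕ} (hpc : p + c ≤ k) (hr : r ≤ c)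
    (hx : ∀ i : Fin k, x.1 i = a ↔ p ≤ (i : ℕ) ∧ (i : ℕ) < p + c) {y : ℕ → ℂ}
    (hy : ∀ i : Fin k, 1 + y i ≠ 0) :
    planeWave (move x a r) y = planeWave x y * ∏ i ∈ range r, (1 + y (p + c - r + i)) := by
  rw [prod_range_eq_prod_filter (k := k) (by omega) (fun i => 1 + y i), prod_filter, planeWave,
    planeWave, ← prod_mul_distrib]
  refine prod_congr rfl fun i _ => ?_
  simp only [move, lowered_iff hpc hr hx]
  split_ifs
  · rw [zpow_sub_one₀ (inv_ne_zero (hy i)), inv_inv]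
  · rw [mul_one]

theorem Psi_eq {k : ℕ} {s q : ℂ} {z : Fin k → ℂ} (hznu : ∀ i, 1 - nu s q * z i ≠ 0)
    (x : Chamber k) : Psi s q z x = ∑ σ : Equiv.Perm (Fin k),
      scattering q (z ∘ σ) * planeWave x (extend (energy s q ∘ z ∘ σ)) := by
  refine sum_congr rfl fun σ _ => ?_
  congr 1
  refine prod_congr rfl fun i _ => ?_
  rw [extend_val, Function.comp_apply, Function.comp_apply, one_add_energy (hznu _), inv_inv]

theorem sum_rate_mul_Psi {k : ℕ} {s q : ℂ}
    (hq : ∀ n : ℕ, 1 ≤ n → n ≤ k → qInt q n ≠ 0)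
    (hs : ∀ n : ℕ, 1 ≤ n → n < k → 1 + s * qInt q n ≠ 0)
    (hnu : 1 - q + s ≠ 0) {z : Fin k → ℂ} (hz : Function.Injective z)
    (hz1 : ∀ i, 1 - z i ≠ 0) (hznu : ∀ i, 1 - nu s q * z i ≠ 0) (x : Chamber k) (a : ℤ) :
    ∑ r ∈ Icc 1 (clusterSize x a), rate s q (clusterSize x a) r *
      (Psi s q z (move x a r) - Psi s q z x) =
    ∑ σ : Equiv.Perm (Fin k), scattering q (z ∘ σ) *
      (planeWave x (extend (energy s q ∘ z ∘ σ)) *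
        ∑ i : Fin k with x.1 i = a, energy s q (z (σ i))) := by
  obtain ⟨p, hpc, hx⟩ := exists_cluster x a
  have h := sum_scattering_mul_eq_zero hnu hz hznu hpc (mul_mem_exchange
    (sum_rate_sub_mem_exchange hq hs p (by omega)) (planeWave_isSymmOn hpc hx))
  rw [← sub_eq_zero, ← h]
  have hmove : ∀ r ∈ Icc 1 (clusterSize x a), rate s q (clusterSize x a) r *
      (Psi s q z (move x a r) - Psi s q z x) = ∑ σ : Equiv.Perm (Fin k), scattering q (z ∘ σ) *
      (rate s q (clusterSize x a) r * (∏ i ∈ range r,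
        (1 + extend (energy s q ∘ z ∘ σ) (p + clusterSize x a - r + i)) - 1) *
        planeWave x (extend (energy s q ∘ z ∘ σ))) := by
    intro r hr
    rw [Psi_eq hznu, Psi_eq hznu, ← sum_sub_distrib, mul_sum]
    refine sum_congr rfl fun σ _ => ?_
    rw [planeWave_move hpc (mem_Icc.mp hr).2 hx fun i => ?_]
    · ring
    · rw [extend_val, Function.comp_apply, Function.comp_apply, one_add_energy (hznu _)]
      exact inv_ne_zero (div_ne_zero (hznu _) (hz1 _))
  rw [sum_congr rfl hmove, sum_comm, ← sum_sub_distrib]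
  refine sum_congr rfl fun σ _ => ?_
  have hE : ∑ i : Fin k with x.1 i = a, energy s q (z (σ i)) =
      ∑ i ∈ range (clusterSize x a), extend (energy s q ∘ z ∘ σ) (p + i) := by
    rw [sum_range_eq_sum_filter hpc]
    simp only [hx, extend_val, Function.comp_apply]
  rw [hE, ← mul_sum, ← sum_mul]
  simp only [Pi.mul_apply, Pi.sub_apply, Finset.sum_apply, Pi.smul_apply, smul_eq_mul]
  ring

theorem generator_Psi {k : ℕ} {s q : ℂ}
    (hq : ∀ n : ℕ, 1 ≤ n → n ≤ k → qInt q n ≠ 0)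
    (hs : ∀ n : ℕ, 1 ≤ n → n < k → 1 + s * qInt q n ≠ 0)
    (hnu : 1 - q + s ≠ 0) {z : Fin k → ℂ} (hz : Function.Injective z)
    (hz1 : ∀ i, 1 - z i ≠ 0) (hznu : ∀ i, 1 - nu s q * z i ≠ 0) :
    generator k s q (Psi s q z) = (∑ i, energy s q (z i)) • Psi s q z := by
  funext x
  change ∑ a ∈ sites x, ∑ r ∈ Icc 1 (clusterSize x a), rate s q (clusterSize x a) r *
    (Psi s q z (move x a r) - Psi s q z x) = _
  rw [sum_congr rfl fun a _ => sum_rate_mul_Psi hq hs hnu hz hz1 hznu x a, sum_comm,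
    Pi.smul_apply, Psi_eq hznu, smul_eq_mul, mul_sum]
  refine sum_congr rfl fun σ _ => ?_
  have hf : ∑ a ∈ sites x, ∑ i : Fin k with x.1 i = a, energy s q (z (σ i)) =
      ∑ i, energy s q (z (σ i)) :=
    sum_fiberwise_of_maps_to (fun i _ => mem_image_of_mem _ (mem_univ i)) _
  rw [← mul_sum, ← mul_sum, hf, Equiv.sum_comp σ fun i => energy s q (z i)]
  ring

theorem Psi_ne_zero {k : ℕ} {s q : ℂ} (hq : ∀ n : ℕ, 1 ≤ n → n ≤ k → qInt q n ≠ 0)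
    {z : Fin k → ℂ} (hz : Function.Injective z) : Psi s q z ≠ 0 := by
  intro h
  have h0 : Psi s q z ⟨fun _ => 0, fun _ _ _ => le_rfl⟩ = qFact q k := by
    rw [← sum_scattering q hz]
    refine sum_congr rfl fun σ _ => ?_
    simp [scattering]
  rw [h] at h0
  exact qFact_ne_zero hq le_rfl h0.symm

end QBoson

theorem mainTheorem3 (k : ℕ) (s q : ℂ)
    (hqint : ∀ n : ℕ, 1 ≤ n → n ≤ k → QBoson.qInt q n ≠ 0)
    (hrate : ∀ n : ℕ, 1 ≤ n → n < k → 1 + s * QBoson.qInt q n ≠ 0)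
    (hnu : 1 - q + s ≠ 0)
    (z : Fin k → ℂ) (hz : Function.Injective z)
    (hz1 : ∀ i, z i ≠ 1) (hznu : ∀ i, QBoson.nu s q * z i ≠ 1) :
    Module.End.HasEigenvector (QBoson.generator k s q)
      ((QBoson.nu s q - 1) * ∑ i, z i / (1 - QBoson.nu s q * z i))
      (QBoson.Psi s q z) := by
  refine ⟨Module.End.mem_eigenspace_iff.mpr ?_, QBoson.Psi_ne_zero hqint hz⟩
  rw [QBoson.generator_Psi hqint hrate hnu hz (fun i => sub_ne_zero.mpr (hz1 i).symm)
    fun i => sub_ne_zero.mpr (hznu i).symm]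
  simp only [QBoson.energy, mul_div_assoc, mul_sum]
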